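/- Write $[n]=\{1,\dots,n\}$, and let $d_{\mathrm{TV}}(p,q)=\frac12\sum_{i\in[n]}|p(i)-q(i)|$ for probability distributions $p,q$ on $[n]$. A conditional sampling oracle for $p$ receives a nonempty query set $S\subseteq[n]$ and returns a random element of $S$, equal to $i \in S$ with probability $p(i)/p(S)$ if $p(S)=\sum_{i\in S}p(i)>0$, and uniform on $S$ if $p(S)=0$; different queries are answered independently. A (randomized) algorithm has NACOND (non-adaptive conditional sampling) access to $p$ if its only access to $p$ is through such an oracle and it submits all its query sets before it sees any of the answers. **Theorem (Non-Adaptive Identity Testing).** There is an algorithm which, given $n$, an accuracy parameter $\varepsilon\in(0,1]$, an explicit description of a distribution $q$ on $[n]$, and NACOND access to an unknown distribution $p$ on $[n]$, makes $\tilde O\!\left(\frac{\log^2 n}{\varepsilon^2}\right)$ queries to the oracle for $p$ and distinguishes between $p=q$ and $d_{\mathrm{TV}}(p,q)\ge\varepsilon$ with probability at least $2/3$: if $p=q$ it answers "equal" with probability at least $2/3$, and if $d_{\mathrm{TV}}(p,q)\ge\varepsilon$ it answers "far" with probability at least $2/3$. Here $\log$ is to base $2$, and $\tilde O(g)$ stands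 for a quantity bounded by $C\,g\,(\log(2+g))^k$ with absolute constants $C$ and $k$, for all $n\ge1$, all $\varepsilon\in(0,1]$ and all $q$, with $g=\log^2 n/\varepsilon^2$. -/

import Mathlib

open scoped ENNReal

noncomputable section

namespace CondSampling

/-- Total variation distance of two distributions on `[n]`: half of the `ℓ₁` distance. -/
def tvDist {n : ℕ} (p q : PMF (Fin n)) : ℝ :=
  (1 / 2) * ∑ i, |(p i).toReal - (q i).toReal|

/-- A query set: a nonempty subset of `[n]` (the oracle has to return one of its elements). -/
abbrev QuerySet (n : ℕ) : Type := {S : Finset (Fin n) // S.Nonempty}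

open Classical in
/-- The law of the answer of the conditional sampling oracle for `p` to the query set `S`.
If `p(S) > 0`, the symbol `i ∈ S` is returned with probability `p(i) / p(S)`; if `p(S) = 0`,
the answer is uniform on `S`. -/
def condOracle {n : ℕ} (p : PMF (Fin n)) (S : QuerySet n) : PMF (Fin n) :=
  if h : ∃ i ∈ (S.1 : Set (Fin n)), i ∈ p.support then p.filter (S.1 : Set (Fin n)) h
  else PMF.uniformOfFinset S.1 S.2

/-- The product of finitely many distributions on `[n]`: the joint law of independent draws. -/
def indepDraws {n m : ℕ} (d : Fin m → PMF (Fin n)) : PMF (Fin m → Fin n) :=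
  PMF.ofFintype (fun a => ∏ t, d t (a t)) (by
    have h := Finset.prod_univ_sum (fun _ : Fin m => (Finset.univ : Finset (Fin n)))
      (fun t i => d t i)
    rw [Fintype.piFinset_univ] at h
    rw [← h]
    refine Finset.prod_eq_one fun t _ => ?_
    have ht := (d t).tsum_coe
    rwa [tsum_fintype] at ht)

/-- A randomized algorithm with access to a non-adaptive conditional sampling oracle for a
distribution on `[n]`. It first draws, using its own randomness, all its query sets; only then does
it see the answers, and from the query sets and the answers (and fresh randomness) it computes its
verdict: `true` for "the two distributions are equal", `false` for "they are far apart". -/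
structure NACondAlgorithm (n : ℕ) where
  /-- the number of queries made to the oracle -/
  numQueries : ℕ
  /-- the random choice of all the query sets -/
  querySets : PMF (Fin numQueries → QuerySet n)
  /-- the verdict, given the query sets and the answers of the oracle -/
  verdict : (Fin numQueries → QuerySet n) → (Fin numQueries → Fin n) → PMF Bool

/-- The law of the verdict when the oracle is the conditional sampling oracle for `p`; given the
query sets, the answers to the queries are independent. -/
def NACondAlgorithm.run {n : ℕ} (A : NACondAlgorithm n) (p : PMF (Fin n)) : PMF Bool :=
  A.querySets.bind fun Q =>
    (indepDraws fun t => condOracle p (Q t)).bind fun a => A.verdict Q a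

end CondSampling

end

/-! Halve `[n]` repeatedly to get a binary tree of depth d, about log n. A distribution is
determined by its branching probabilities at the nodes: the conditional probability (`leftProb`)
that an answer to the query S falls in `half S`. Hence if p and q are far apart, their branching
probabilities must differ somewhere, and this can be charged to the known q. Passing from a node to
its children raises the sum of |p - q| over the pieces by at most twice the q-mass of the node times
its `discrepancy`. Summing over the tree (`sum_abs_sub_le`) shows that a random node on the branch
of an i drawn from q, at a uniform level, has expected discrepancy at least tvDist/d
(`tvDist_div_le_expect_discrepancy`).

It remains to detect that a [0,1]-valued variable has mean at least ε/d. By dyadic bucketing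
(`exists_scale`), for some j < J with 2^J about d/ε, the discrepancy is at least 2^-(j+1) with
probability at least 2^j 2^-J / J. So at each scale about J 2^(J-j) nodes are drawn, and each is
queried about J 4^j times, enough by a Chernoff bound to see a discrepancy of that size. All nodes
are drawn in advance, so no adaptivity is needed. Each scale costs about J^2 2^J 2^j, in total J^2
4^J, which is (log n / ε)^2 up to logarithmic factors. The blocks are independent, so the acceptance
probability is a product (`run_blockTester_true`). -/

noncomputable section

namespace CondSampling

variable {n : ℕ}

/-! ### The halving tree and the branching probabilities -/

/-- The probabilities of a distribution on a finite type, as real numbers, sum to one. -/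
lemma sum_toReal_eq_one {α : Type*} [Fintype α] (p : PMF α) : ∑ i, (p i).toReal = 1 := by
  have h := p.tsum_coe
  rw [tsum_fintype] at h
  rw [← ENNReal.toReal_sum (fun i _ => p.apply_ne_top i), h, ENNReal.toReal_one]

/-- A subset of `S` with half of its elements, rounded down. -/
def half (S : Finset (Fin n)) : Finset (Fin n) :=
  (Finset.exists_subset_card_eq (Nat.div_le_self S.card 2)).choose

lemma half_subset (S : Finset (Fin n)) : half S ⊆ S :=
  (Finset.exists_subset_card_eq (Nat.div_le_self S.card 2)).choose_spec.1

lemma card_half (S : Finset (Fin n)) : (half S).card = S.card / 2 :=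
  (Finset.exists_subset_card_eq (Nat.div_le_self S.card 2)).choose_spec.2

/-- The set containing `i` after `l` rounds of repeatedly halving `S`. -/
def node (S : Finset (Fin n)) (i : Fin n) : ℕ → Finset (Fin n)
  | 0 => S
  -- A singleton has empty half, so a branch that has reached a leaf stays there.
  | l + 1 => node (if i ∈ half S then half S else S \ half S) i l

lemma mem_node {S : Finset (Fin n)} {i : Fin n} (hi : i ∈ S) (l : ℕ) : i ∈ node S i l := by
  induction l generalizing S with
  | zero => exact hi
  | succ l ih =>
    rw [node]
    apply ih
    split_ifs with h
    · exact h
    · exact Finset.mem_sdiff.2 ⟨hi, h⟩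

/-- The probability that the answer to the query `S` lies in `half S`. -/
def leftProb (p : PMF (Fin n)) (S : QuerySet n) : ℝ :=
  ∑ a ∈ half S.1, (condOracle p S a).toReal

lemma leftProb_nonneg (p : PMF (Fin n)) (S : QuerySet n) : 0 ≤ leftProb p S :=
  Finset.sum_nonneg fun _ _ => ENNReal.toReal_nonneg

lemma leftProb_le_one (p : PMF (Fin n)) (S : QuerySet n) : leftProb p S ≤ 1 := by
  rw [← sum_toReal_eq_one (condOracle p S)]
  exact Finset.sum_le_sum_of_subset_of_nonneg (Finset.subset_univ _)
    fun _ _ _ => ENNReal.toReal_nonneg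

/-- How much the oracles for `p` and `q` differ in the probability of answering in `half S`. -/
def discrepancy (p q : PMF (Fin n)) (S : QuerySet n) : ℝ := |leftProb p S - leftProb q S|

lemma discrepancy_le_one (p q : PMF (Fin n)) (S : QuerySet n) : discrepancy p q S ≤ 1 := by
  have h1 := leftProb_nonneg p S
  have h2 := leftProb_le_one p S
  have h3 := leftProb_nonneg q S
  have h4 := leftProb_le_one q S
  exact abs_le.2 ⟨by linarith, by linarith⟩

/-- Multiplying by the mass of S makes the convention for p(S) = 0 harmless: both sides then vanish.
-/
lemma mass_mul_condOracle (p : PMF (Fin n)) (S : QuerySet n) {a : Fin n} (ha : a ∈ S.1) :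
    (∑ i ∈ S.1, (p i).toReal) * (condOracle p S a).toReal = (p a).toReal := by
  classical
  by_cases h : ∃ i ∈ (S.1 : Set (Fin n)), i ∈ p.support
  · have hsum : ∑' a', (S.1 : Set (Fin n)).indicator p a' = ∑ i ∈ S.1, p i := by
      rw [tsum_fintype, ← Finset.sum_indicator_subset (fun i => p i) (Finset.subset_univ S.1)]
    have hpos : 0 < ∑ i ∈ S.1, (p i).toReal := by
      obtain ⟨i, hi, hip⟩ := h
      refine Finset.sum_pos' (fun _ _ => ENNReal.toReal_nonneg) ⟨i, hi, ?_⟩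
      exact ENNReal.toReal_pos ((p.mem_support_iff i).1 hip) (p.apply_ne_top i)
    rw [condOracle, dif_pos h, PMF.filter_apply, hsum, Set.indicator_of_mem (by exact_mod_cast ha),
      ENNReal.toReal_mul, ENNReal.toReal_inv, ENNReal.toReal_sum (fun i _ => p.apply_ne_top i)]
    field_simp
  · have h0 : ∀ i ∈ S.1, p i = 0 := by
      intro i hi
      by_contra hne
      exact h ⟨i, hi, (p.mem_support_iff i).2 hne⟩
    rw [Finset.sum_eq_zero (fun i hi => by rw [h0 i hi, ENNReal.toReal_zero]), h0 a ha]
    simp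

/-! ### Total variation bounded by discrepancies along branches -/

lemma mass_half (p : PMF (Fin n)) (S : QuerySet n) :
    ∑ i ∈ half S.1, (p i).toReal = (∑ i ∈ S.1, (p i).toReal) * leftProb p S := by
  rw [leftProb, Finset.mul_sum]
  exact Finset.sum_congr rfl fun a ha => (mass_mul_condOracle p S (half_subset _ ha)).symm

/-- Here P, Q are the masses of a node under p, q and x, y the branching probabilities. Writing P x
- Q y = (P - Q) x + Q (x - y), and similarly for the other child, puts only the mass under q in
front of |x - y|. This is why nodes can be sampled from the known distribution. -/
lemma abs_split_le {P Q x y : ℝ} (hQ : 0 ≤ Q) (hx : 0 ≤ x) (hx1 : x ≤ 1) :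
    |P * x - Q * y| + |P * (1 - x) - Q * (1 - y)| ≤ |P - Q| + 2 * (Q * |x - y|) := by
  have e1 : P * x - Q * y = (P - Q) * x + Q * (x - y) := by ring
  have e2 : P * (1 - x) - Q * (1 - y) = (P - Q) * (1 - x) + -(Q * (x - y)) := by ring
  have h1 := abs_add_le ((P - Q) * x) (Q * (x - y))
  have h2 := abs_add_le ((P - Q) * (1 - x)) (-(Q * (x - y)))
  rw [abs_neg, abs_mul, abs_mul, abs_of_nonneg hQ, abs_of_nonneg (sub_nonneg.2 hx1)] at h2
  rw [abs_mul, abs_mul, abs_of_nonneg hQ, abs_of_nonneg hx] at h1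
  rw [e1, e2]
  linarith

/-- The discrepancy at a set which is allowed to be empty. -/
def discrepancyAt (p q : PMF (Fin n)) (S : Finset (Fin n)) : ℝ :=
  if h : S.Nonempty then discrepancy p q ⟨S, h⟩ else 0

/-- Induction on the depth: apply the bound to the two halves, then `abs_split_le` to the two mass
differences that arise. At a singleton only the mass difference is left. -/
lemma sum_abs_sub_le (p q : PMF (Fin n)) (d : ℕ) (S : Finset (Fin n)) (hS : S.card ≤ 2 ^ d) :
    ∑ i ∈ S, |(p i).toReal - (q i).toReal| ≤
      |∑ i ∈ S, (p i).toReal - ∑ i ∈ S, (q i).toReal| +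
        2 * ∑ i ∈ S, (q i).toReal * ∑ l ∈ Finset.range d, discrepancyAt p q (node S i l) := by
  induction d generalizing S with
  | zero =>
    rw [pow_zero] at hS
    rcases S.eq_empty_or_nonempty with rfl | hne
    · simp
    · obtain ⟨a, rfl⟩ := Finset.card_eq_one.1 (le_antisymm hS hne.card_pos)
      simp
  | succ d ih =>
    rcases S.eq_empty_or_nonempty with rfl | hne
    · simp
    have hA : (half S).card ≤ 2 ^ d := by
      rw [card_half]; rw [pow_succ] at hS; omega
    have hB : (S \ half S).card ≤ 2 ^ d := by
      rw [Finset.card_sdiff_of_subset (half_subset S), card_half]; rw [pow_succ] at hS; omega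
    have hsplit : ∀ f : Fin n → ℝ, ∑ i ∈ S, f i = ∑ i ∈ half S, f i + ∑ i ∈ S \ half S, f i :=
      fun f => by rw [add_comm]; exact (Finset.sum_sdiff (half_subset S)).symm
    have hiA : ∀ i ∈ half S, (q i).toReal *
        ∑ l ∈ Finset.range (d + 1), discrepancyAt p q (node S i l) =
          (q i).toReal * (∑ l ∈ Finset.range d, discrepancyAt p q (node (half S) i l)) +
          (q i).toReal * discrepancyAt p q S := by
      intro i hi
      -- The level-0 term is the discrepancy at S itself; the remaining levels are those of the
      -- child containing i.
      rw [Finset.sum_range_succ', mul_add]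
      simp only [node, if_pos hi]
    have hiB : ∀ i ∈ S \ half S, (q i).toReal *
        ∑ l ∈ Finset.range (d + 1), discrepancyAt p q (node S i l) =
          (q i).toReal * (∑ l ∈ Finset.range d, discrepancyAt p q (node (S \ half S) i l)) +
          (q i).toReal * discrepancyAt p q S := by
      intro i hi
      rw [Finset.sum_range_succ', mul_add]
      simp only [node, if_neg (Finset.mem_sdiff.1 hi).2]
    have hr : ∀ r : PMF (Fin n), ∑ i ∈ S \ half S, (r i).toReal =
        (∑ i ∈ S, (r i).toReal) * (1 - leftProb r ⟨S, hne⟩) := by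
      intro r
      have h1 := mass_half r ⟨S, hne⟩
      have h2 := hsplit fun i => (r i).toReal
      simp only at h1 h2
      linarith
    have key := abs_split_le (P := ∑ i ∈ S, (p i).toReal) (Q := ∑ i ∈ S, (q i).toReal)
      (x := leftProb p ⟨S, hne⟩) (y := leftProb q ⟨S, hne⟩)
      (Finset.sum_nonneg fun _ _ => ENNReal.toReal_nonneg) (leftProb_nonneg _ _)
      (leftProb_le_one _ _)
    rw [← hr p, ← hr q, ← mass_half p ⟨S, hne⟩, ← mass_half q ⟨S, hne⟩] at key
    have hD : |leftProb p ⟨S, hne⟩ - leftProb q ⟨S, hne⟩| = discrepancyAt p q S := by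
      rw [discrepancyAt, dif_pos hne, discrepancy]
    rw [hD] at key
    have ihA := ih _ hA
    have ihB := ih _ hB
    rw [hsplit fun i => |(p i).toReal - (q i).toReal|,
      hsplit fun i => (q i).toReal * ∑ l ∈ Finset.range (d + 1), discrepancyAt p q (node S i l),
      Finset.sum_congr rfl hiA, Finset.sum_congr rfl hiB, Finset.sum_add_distrib,
      Finset.sum_add_distrib, ← Finset.sum_mul, ← Finset.sum_mul]
    have hq := congrArg (· * discrepancyAt p q S) (hsplit fun i => (q i).toReal)
    simp only [add_mul] at hq
    linarith

/-- At the root both masses are 1, so the mass difference vanishes, and the factor 2 cancels the 1/2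
of the total variation distance. -/
lemma tvDist_le_sum_discrepancyAt (p q : PMF (Fin n)) (d : ℕ) (hd : n ≤ 2 ^ d) :
    tvDist p q ≤ ∑ i, (q i).toReal *
      ∑ l ∈ Finset.range d, discrepancyAt p q (node Finset.univ i l) := by
  have h := sum_abs_sub_le p q d Finset.univ (by simpa using hd)
  rw [sum_toReal_eq_one, sum_toReal_eq_one, sub_self, abs_zero, zero_add] at h
  rw [tvDist]
  linarith

/-! ### Random nodes and expectations -/

/-- A random node: the set containing an element drawn from `q`, after a uniformly random number
`l < d` of rounds of halving. -/
def randomNode (q : PMF (Fin n)) (d : ℕ) [NeZero d] : PMF (QuerySet n) :=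
  q.bind fun i => (PMF.uniformOfFintype (Fin d)).map fun l : Fin d =>
    ⟨node Finset.univ i l, ⟨i, mem_node (Finset.mem_univ i) l⟩⟩

/-- The expectation of a real function on a finite type. -/
def expect {α : Type*} [Fintype α] (D : PMF α) (f : α → ℝ) : ℝ := ∑ a, (D a).toReal * f a

lemma expect_bind {α β : Type*} [Fintype α] [Fintype β] (D : PMF α) (K : α → PMF β) (f : β → ℝ) :
    expect (D.bind K) f = expect D fun a => expect (K a) f := by
  simp only [expect, PMF.bind_apply, tsum_fintype, Finset.mul_sum]
  rw [Finset.sum_comm]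
  refine Finset.sum_congr rfl fun b _ => ?_
  rw [ENNReal.toReal_sum fun a _ => ENNReal.mul_ne_top (D.apply_ne_top a) ((K a).apply_ne_top b),
    Finset.sum_mul]
  simp only [ENNReal.toReal_mul, mul_assoc]

lemma expect_pure {β : Type*} [Fintype β] (b : β) (f : β → ℝ) :
    expect (PMF.pure b) f = f b := by
  classical
  simp [expect, PMF.pure_apply, apply_ite ENNReal.toReal]

lemma expect_map {α β : Type*} [Fintype α] [Fintype β] (D : PMF α) (g : α → β) (f : β → ℝ) :
    expect (D.map g) f = expect D fun a => f (g a) := by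
  rw [PMF.map, expect_bind]
  simp only [Function.comp_apply, expect_pure]

lemma discrepancyAt_coe (p q : PMF (Fin n)) (S : QuerySet n) :
    discrepancyAt p q S.1 = discrepancy p q S := by
  rw [discrepancyAt, dif_pos S.2]

lemma expect_randomNode (q : PMF (Fin n)) (d : ℕ) [NeZero d] (f : QuerySet n → ℝ) :
    expect (randomNode q d) f = expect q fun i => expect (PMF.uniformOfFintype (Fin d)) fun l =>
      f ⟨node Finset.univ i l, ⟨i, mem_node (Finset.mem_univ i) l⟩⟩ := by
  rw [randomNode, expect_bind]
  exact congrArg (expect q) (funext fun i => expect_map _ _ f)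

/-- Replacing the sum over the d levels by a uniformly random level costs the factor d. -/
lemma tvDist_div_le_expect_discrepancy (p q : PMF (Fin n)) (d : ℕ) [NeZero d] (hd : n ≤ 2 ^ d) :
    tvDist p q / d ≤ expect (randomNode q d) (discrepancy p q) := by
  have hpos : (0 : ℝ) < d := Nat.cast_pos.2 (Nat.pos_of_ne_zero (NeZero.ne d))
  rw [div_le_iff₀ hpos, expect_randomNode]
  refine (tvDist_le_sum_discrepancyAt p q d hd).trans_eq ?_
  simp only [expect, PMF.uniformOfFintype_apply, Fintype.card_fin, ENNReal.toReal_inv,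
    ENNReal.toReal_natCast, Finset.sum_mul]
  refine Finset.sum_congr rfl fun i _ => ?_
  rw [mul_assoc]
  congr 1
  rw [← Finset.mul_sum, mul_comm, ← mul_assoc, mul_inv_cancel₀ hpos.ne', one_mul,
    Finset.sum_range]
  refine Finset.sum_congr rfl fun l _ => ?_
  exact (discrepancyAt_coe p q ⟨node Finset.univ i l, ⟨i, mem_node (Finset.mem_univ i) l⟩⟩).symm ▸ rfl

lemma sum_pi_prod {ι R : Type*} [Fintype ι] [DecidableEq ι] [CommSemiring R] {β : ι → Type*}
    [∀ i, Fintype (β i)] (F : (i : ι) → β i → R) :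
    ∑ b : (i : ι) → β i, ∏ i, F i (b i) = ∏ i, ∑ x, F i x := by
  have h := Finset.prod_univ_sum (fun i => (Finset.univ : Finset (β i))) F
  rw [Fintype.piFinset_univ] at h
  exact h.symm

/-! ### A Chernoff bound from exponential moments -/

section Concentration

variable {α : Type*} [Fintype α]

/-- For |x| ≤ 1 one has e^x ≤ 1 + x + x^2; the linear term averages to zero, and 1 + r^2 ≤ e^(r^2).
-/
lemma sum_mul_exp_le {w f : α → ℝ} (hw : ∀ a, 0 ≤ w a) (hw1 : ∑ a, w a = 1)
    (hf : ∀ a, |f a| ≤ 1) (hmean : ∑ a, w a * f a = 0) {r : ℝ} (hr : |r| ≤ 1) :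
    ∑ a, w a * Real.exp (r * f a) ≤ Real.exp (r ^ 2) := by
  have hle : ∀ a, w a * Real.exp (r * f a) ≤ w a * (1 + r ^ 2) + r * (w a * f a) := by
    intro a
    have h1 : |r * f a| ≤ 1 := by
      rw [abs_mul]; exact mul_le_one₀ hr (abs_nonneg _) (hf a)
    have h2 := (abs_le.1 (Real.abs_exp_sub_one_sub_id_le h1)).2
    have h3 : (r * f a) ^ 2 ≤ r ^ 2 := by
      rw [mul_pow]
      exact mul_le_of_le_one_right (sq_nonneg r) ((sq_le_one_iff_abs_le_one _).2 (hf a))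
    have h4 := mul_le_mul_of_nonneg_left
      (show Real.exp (r * f a) ≤ (1 + r ^ 2) + r * f a by linarith) (hw a)
    linarith
  refine (Finset.sum_le_sum fun a _ => hle a).trans ?_
  rw [Finset.sum_add_distrib, ← Finset.sum_mul, ← Finset.mul_sum, hw1, hmean]
  have := Real.add_one_le_exp (r ^ 2)
  linarith

lemma sum_prod_mul_exp_le {w f : α → ℝ} (hw : ∀ a, 0 ≤ w a) (hw1 : ∑ a, w a = 1)
    (hf : ∀ a, |f a| ≤ 1) (hmean : ∑ a, w a * f a = 0) {r : ℝ} (hr : |r| ≤ 1) (k : ℕ) :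
    ∑ b : Fin k → α, (∏ s, w (b s)) * Real.exp (r * ∑ s, f (b s)) ≤ Real.exp (k * r ^ 2) := by
  have h1 : ∀ b : Fin k → α, (∏ s, w (b s)) * Real.exp (r * ∑ s, f (b s)) =
      ∏ s, w (b s) * Real.exp (r * f (b s)) := by
    intro b
    rw [Finset.mul_sum, Real.exp_sum, Finset.prod_mul_distrib]
  simp only [h1]
  rw [sum_pi_prod fun (_ : Fin k) a => w a * Real.exp (r * f a), Finset.prod_const,
    Finset.card_univ, Fintype.card_fin, Real.exp_nat_mul]
  exact pow_le_pow_left₀ (Finset.sum_nonneg fun a _ => mul_nonneg (hw a) (Real.exp_pos _).le)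
    (sum_mul_exp_le hw hw1 hf hmean hr) k

open Classical in
/-- A Chernoff bound for sums of `k` independent, bounded and centred variables. -/
lemma sum_prod_mul_tail_le {w f : α → ℝ} (hw : ∀ a, 0 ≤ w a) (hw1 : ∑ a, w a = 1)
    (hf : ∀ a, |f a| ≤ 1) (hmean : ∑ a, w a * f a = 0) {t : ℝ} (ht : 0 ≤ t) (ht2 : t ≤ 2) (k : ℕ) :
    ∑ b : Fin k → α, (∏ s, w (b s)) * (if k * t ≤ |∑ s, f (b s)| then 1 else 0) ≤
      2 * Real.exp (-(k * t ^ 2 / 4)) := by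
  have hle : ∀ b : Fin k → α,
      (∏ s, w (b s)) * (if k * t ≤ |∑ s, f (b s)| then 1 else 0) ≤
        ((∏ s, w (b s)) * Real.exp (t / 2 * ∑ s, f (b s)) +
          (∏ s, w (b s)) * Real.exp (-(t / 2) * ∑ s, f (b s))) *
            Real.exp (-(k * t ^ 2 / 2)) := by
    intro b
    rw [← mul_add, mul_assoc, add_mul, ← Real.exp_add, ← Real.exp_add]
    refine mul_le_mul_of_nonneg_left ?_ (Finset.prod_nonneg fun s _ => hw _)
    split_ifs with h
    · rcases le_abs.1 h with h | h
      · have : (1 : ℝ) ≤ Real.exp (t / 2 * ∑ s, f (b s) + -(k * t ^ 2 / 2)) :=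
          Real.one_le_exp (by nlinarith)
        linarith [Real.exp_pos (-(t / 2) * ∑ s, f (b s) + -(k * t ^ 2 / 2))]
      · have : (1 : ℝ) ≤ Real.exp (-(t / 2) * ∑ s, f (b s) + -(k * t ^ 2 / 2)) :=
          Real.one_le_exp (by nlinarith)
        linarith [Real.exp_pos (t / 2 * ∑ s, f (b s) + -(k * t ^ 2 / 2))]
    · positivity
  refine (Finset.sum_le_sum fun b _ => hle b).trans ?_
  -- The parameter r = t/2 minimises k r^2 - k r t, with value -k t^2/4; the assumption t ≤ 2 keeps
  -- it in the range of the moment bound.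
  have hr : |t / 2| ≤ 1 := abs_le.2 ⟨by linarith, by linarith⟩
  have h1 := sum_prod_mul_exp_le hw hw1 hf hmean hr k
  have h2 := sum_prod_mul_exp_le hw hw1 hf hmean (r := -(t / 2)) (by rwa [abs_neg]) k
  rw [neg_sq] at h2
  rw [← Finset.sum_mul, Finset.sum_add_distrib]
  refine (mul_le_mul_of_nonneg_right (add_le_add h1 h2) (Real.exp_pos _).le).trans_eq ?_
  rw [← two_mul, mul_assoc, ← Real.exp_add]
  congr 2
  ring

end Concentration

/-! ### The test of a single query set -/

/-- The law of a family of independent draws from `D`. -/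
def productPMF {α : Type*} [Fintype α] (ι : Type*) [Fintype ι] [DecidableEq ι] (D : PMF α) :
    PMF (ι → α) :=
  PMF.ofFintype (fun b => ∏ i, D (b i)) (by
    rw [sum_pi_prod fun (_ : ι) a => D a]
    refine Finset.prod_eq_one fun _ _ => ?_
    have h := D.tsum_coe
    rwa [tsum_fintype] at h)

open Classical in
/-- The centred number of answers, among `b`, to the query `S` that lie in `half S`, when each
answer does so with probability `c`. -/
def centredCount {k : ℕ} (c : ℝ) (S : QuerySet n) (b : Fin k → Fin n) : ℝ :=
  ∑ s, ((if b s ∈ half S.1 then 1 else 0) - c)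

open Classical in
/-- The probability that, among `k` independent answers to the query `S`, the number of those in
`half S` is within `τ` of its expectation for `q`. -/
def acceptProb (p q : PMF (Fin n)) (k : ℕ) (τ : ℝ) (S : QuerySet n) : ℝ :=
  ∑ b : Fin k → Fin n, (∏ s, (condOracle p S (b s)).toReal) *
    (if |centredCount (leftProb q S) S b| < τ then 1 else 0)

lemma sum_condOracle_mul_eq_zero (p : PMF (Fin n)) (S : QuerySet n) [DecidableEq (Fin n)] :
    ∑ a, (condOracle p S a).toReal * ((if a ∈ half S.1 then 1 else 0) - leftProb p S) = 0 := by
  simp only [mul_sub, Finset.sum_sub_distrib, mul_ite, mul_one, mul_zero]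
  rw [← Finset.sum_mul, sum_toReal_eq_one, one_mul, leftProb, sub_eq_zero, Finset.sum_ite_mem,
    Finset.univ_inter]

lemma abs_indicator_sub_le_one {P : Prop} [Decidable P] {c : ℝ} (h0 : 0 ≤ c) (h1 : c ≤ 1) :
    |(if P then (1 : ℝ) else 0) - c| ≤ 1 := by
  split_ifs <;> exact abs_le.2 ⟨by linarith, by linarith⟩

open Classical in
lemma tail_centredCount_le (p : PMF (Fin n)) (S : QuerySet n) {t : ℝ} (ht : 0 ≤ t) (ht2 : t ≤ 2)
    (k : ℕ) :
    ∑ b : Fin k → Fin n, (∏ s, (condOracle p S (b s)).toReal) *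
      (if k * t ≤ |centredCount (leftProb p S) S b| then 1 else 0) ≤
        2 * Real.exp (-(k * t ^ 2 / 4)) :=
  sum_prod_mul_tail_le (fun _ => ENNReal.toReal_nonneg) (sum_toReal_eq_one _)
    (fun _ => abs_indicator_sub_le_one (leftProb_nonneg p S) (leftProb_le_one p S))
    (sum_condOracle_mul_eq_zero p S) ht ht2 k

lemma sum_prod_condOracle (p : PMF (Fin n)) (S : QuerySet n) (k : ℕ) :
    ∑ b : Fin k → Fin n, ∏ s, (condOracle p S (b s)).toReal = 1 := by
  rw [sum_pi_prod fun (_ : Fin k) a => (condOracle p S a).toReal]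
  exact Finset.prod_eq_one fun _ _ => sum_toReal_eq_one _

lemma one_sub_le_acceptProb_self (p : PMF (Fin n)) (S : QuerySet n) {t : ℝ} (ht : 0 ≤ t)
    (ht2 : t ≤ 2) (k : ℕ) :
    1 - 2 * Real.exp (-(k * t ^ 2 / 4)) ≤ acceptProb p p k (k * t) S := by
  classical
  have h := tail_centredCount_le p S ht ht2 k
  have h1 : acceptProb p p k (k * t) S + ∑ b : Fin k → Fin n,
      (∏ s, (condOracle p S (b s)).toReal) *
        (if k * t ≤ |centredCount (leftProb p S) S b| then 1 else 0) = 1 := by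
    rw [acceptProb, ← Finset.sum_add_distrib]
    refine Eq.trans ?_ (sum_prod_condOracle p S k)
    refine Finset.sum_congr rfl fun b _ => ?_
    rw [← mul_add]
    by_cases hb : k * t ≤ |centredCount (leftProb p S) S b|
    · simp [hb, not_lt.2 hb]
    · simp [hb, not_le.1 hb]
  linarith

lemma acceptProb_nonneg (p q : PMF (Fin n)) (k : ℕ) (τ : ℝ) (S : QuerySet n) :
    0 ≤ acceptProb p q k τ S :=
  Finset.sum_nonneg fun b _ => mul_nonneg (Finset.prod_nonneg fun _ _ => ENNReal.toReal_nonneg)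
    (by split_ifs <;> norm_num)

lemma acceptProb_le_one (p q : PMF (Fin n)) (k : ℕ) (τ : ℝ) (S : QuerySet n) :
    acceptProb p q k τ S ≤ 1 := by
  rw [← sum_prod_condOracle p S k]
  refine Finset.sum_le_sum fun b _ => ?_
  exact mul_le_of_le_one_right (Finset.prod_nonneg fun _ _ => ENNReal.toReal_nonneg)
    (by split_ifs <;> norm_num)

/-- The counts centred for q and for p differ by k times the difference of the branching
probabilities, at least 2kt in absolute value. So a count within kt of its mean for q is at least kt
away from its mean for p. -/
lemma acceptProb_le_of_le_discrepancy (p q : PMF (Fin n)) (S : QuerySet n) {t : ℝ} (ht : 0 ≤ t)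
    (ht2 : t ≤ 2) (k : ℕ) (h : 2 * t ≤ discrepancy p q S) :
    acceptProb p q k (k * t) S ≤ 2 * Real.exp (-(k * t ^ 2 / 4)) := by
  classical
  refine le_trans (Finset.sum_le_sum fun b _ => ?_) (tail_centredCount_le p S ht ht2 k)
  refine mul_le_mul_of_nonneg_left ?_ (Finset.prod_nonneg fun _ _ => ENNReal.toReal_nonneg)
  by_cases hb : |centredCount (leftProb q S) S b| < k * t
  · have hc : centredCount (leftProb q S) S b =
        centredCount (leftProb p S) S b + k * (leftProb p S - leftProb q S) := by
      simp only [centredCount, Finset.sum_sub_distrib, Finset.sum_const, Finset.card_univ,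
        Fintype.card_fin, nsmul_eq_mul]
      ring
    have h1 : k * (2 * t) ≤ |k * (leftProb p S - leftProb q S)| := by
      rw [abs_mul, Nat.abs_cast]
      exact mul_le_mul_of_nonneg_left h (Nat.cast_nonneg k)
    have h2 := abs_sub (centredCount (leftProb q S) S b) (centredCount (leftProb p S) S b)
    rw [show centredCount (leftProb q S) S b - centredCount (leftProb p S) S b =
      k * (leftProb p S - leftProb q S) by rw [hc]; ring] at h2
    rw [if_pos hb, if_pos (by linarith)]
  · rw [if_neg hb]
    split_ifs <;> norm_num

/-! ### Independent blocks and the product formula -/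

section Blocks

variable {ι : Type} [Fintype ι] [DecidableEq ι]

/-- An enumeration of the queries of a tester which makes `k i` queries in block `i`. -/
def queryIndex (k : ι → ℕ) : Fin (Fintype.card (Σ i, Fin (k i))) ≃ Σ i, Fin (k i) :=
  (Fintype.equivFin _).symm

open Classical in
/-- The verdict "equal" is given if in each block the number of answers which lie in the chosen half
of the query set is within `τ i` of its expectation for `q`. -/
def blockVerdict (q : PMF (Fin n)) (k : ι → ℕ) (τ : ι → ℝ)
    (Q : Fin (Fintype.card (Σ i, Fin (k i))) → QuerySet n)
    (a : Fin (Fintype.card (Σ i, Fin (k i))) → Fin n) : PMF Bool :=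
  PMF.pure (decide (∀ i, |∑ s : Fin (k i),
    ((if a ((queryIndex k).symm ⟨i, s⟩) ∈ half (Q ((queryIndex k).symm ⟨i, s⟩)).1 then 1 else 0) -
      leftProb q (Q ((queryIndex k).symm ⟨i, s⟩)))| < τ i))

/-- The tester that draws for each `i` an independent query set from `D`, queries it `k i` times,
and compares the answers in each of these blocks with what is expected for `q`. -/
def blockTester (D : PMF (QuerySet n)) (q : PMF (Fin n)) (k : ι → ℕ) (τ : ι → ℝ) :
    NACondAlgorithm n where
  numQueries := Fintype.card (Σ i, Fin (k i))
  querySets := (productPMF ι D).map fun S t => S (queryIndex k t).1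
  verdict := blockVerdict q k τ

lemma run_blockTester (D : PMF (QuerySet n)) (p q : PMF (Fin n)) (k : ι → ℕ) (τ : ι → ℝ) :
    (blockTester D q k τ).run p =
      ((productPMF ι D).map fun S t => S (queryIndex k t).1).bind fun Q =>
        (indepDraws fun t => condOracle p (Q t)).bind fun a => blockVerdict q k τ Q a := rfl

lemma toReal_apply_eq_expect {α : Type*} [Fintype α] [DecidableEq α] (D : PMF α) (a : α) :
    (D a).toReal = expect D fun x => if x = a then 1 else 0 := by
  simp [expect]

/-- A family of answers to all queries is, by currying, a family of answers for each block; the sum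
of a product over blocks then factorises. -/
lemma sum_blocks {α : Type*} [Fintype α] (k : ι → ℕ) (w : ι → α → ℝ)
    (g : (i : ι) → (Fin (k i) → α) → ℝ) :
    ∑ a : Fin (Fintype.card (Σ i, Fin (k i))) → α, (∏ t, w (queryIndex k t).1 (a t)) *
        ∏ i, g i (fun s => a ((queryIndex k).symm ⟨i, s⟩)) =
      ∏ i, ∑ b : Fin (k i) → α, (∏ s, w i (b s)) * g i b := by
  rw [← sum_pi_prod fun i (b : Fin (k i) → α) => (∏ s, w i (b s)) * g i b]
  refine Fintype.sum_equiv
    (((queryIndex k).arrowCongr (Equiv.refl α)).trans (Equiv.piCurry fun _ _ => α)) _ _ fun a => ?_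
  rw [Finset.prod_mul_distrib]
  congr 1
  rw [← Equiv.prod_comp (queryIndex k).symm, Fintype.prod_sigma]
  simp [Sigma.curry]

/-- For fixed query sets the blocks of answers are independent, and the query sets are themselves
independent draws from `D`, so the acceptance probability factorises twice. -/
lemma run_blockTester_true (D : PMF (QuerySet n)) (p q : PMF (Fin n)) (k : ι → ℕ) (τ : ι → ℝ) :
    ((blockTester D q k τ).run p true).toReal =
      ∏ i, expect D (acceptProb p q (k i) (τ i)) := by
  classical
  rw [toReal_apply_eq_expect, run_blockTester, expect_bind, expect_map]
  simp only [expect_bind]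
  have hinner : ∀ S : ι → QuerySet n,
      expect (indepDraws fun t => condOracle p (S (queryIndex k t).1)) (fun a =>
        expect (blockVerdict q k τ (fun t => S (queryIndex k t).1) a)
          fun x => if x = true then 1 else 0) = ∏ i, acceptProb p q (k i) (τ i) (S i) := by
    intro S
    unfold acceptProb
    rw [← sum_blocks k (fun i a => (condOracle p (S i) a).toReal) fun i b =>
      if |centredCount (leftProb q (S i)) (S i) b| < τ i then 1 else 0]
    refine Finset.sum_congr rfl fun a _ => ?_
    simp only [blockVerdict, expect_pure, indepDraws, PMF.ofFintype_apply, ENNReal.toReal_prod,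
      Equiv.apply_symm_apply, decide_eq_true_eq]
    congr 1
    rw [Finset.prod_ite_zero, Finset.prod_const_one]
    simp [centredCount]
  refine (congrArg (expect _) (funext hinner)).trans ?_
  simp only [expect, productPMF, PMF.ofFintype_apply, ENNReal.toReal_prod,
    ← Finset.prod_mul_distrib]
  exact sum_pi_prod fun i S => (D S).toReal * acceptProb p q (k i) (τ i) S

end Blocks

/-! ### Dyadic scales of a bounded variable -/

section Expect

variable {α : Type*} [Fintype α]

lemma expect_mono (D : PMF α) {f g : α → ℝ} (h : ∀ a, f a ≤ g a) : expect D f ≤ expect D g :=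
  Finset.sum_le_sum fun a _ => mul_le_mul_of_nonneg_left (h a) ENNReal.toReal_nonneg

lemma expect_const (D : PMF α) (c : ℝ) : expect D (fun _ => c) = c := by
  rw [expect, ← Finset.sum_mul, sum_toReal_eq_one, one_mul]

lemma expect_const_add_mul (D : PMF α) (b c : ℝ) (f : α → ℝ) :
    expect D (fun a => b + c * f a) = b + c * expect D f := by
  conv_rhs => rw [← expect_const D b]
  simp only [expect, mul_add, Finset.sum_add_distrib, Finset.mul_sum]
  congr 1
  exact Finset.sum_congr rfl fun a _ => by ring

lemma expect_sum (D : PMF α) {ι : Type*} (s : Finset ι) (f : ι → α → ℝ) :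
    expect D (fun a => ∑ i ∈ s, f i a) = ∑ i ∈ s, expect D (f i) := by
  simp only [expect, Finset.mul_sum]
  exact Finset.sum_comm

open Classical in
-- Either x lies below the finest scale 2^-J, or the indicator of the scale just below x contributes
-- enough. The redundant `1 *` and `0 +` give the right side the shape of `expect_const_add_mul`.
lemma le_dyadic_sum {x : ℝ} (hx : x ≤ 1) (J : ℕ) :
    x ≤ (1 / 2) ^ J + 1 * ∑ j ∈ Finset.range J,
      (0 + (1 / 2) ^ j * if (1 / 2) ^ (j + 1) ≤ x then (1 : ℝ) else 0) := by
  induction J with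
  | zero => simpa using hx
  | succ J ih =>
    rw [Finset.sum_range_succ]
    have hp : (0 : ℝ) < (1 / 2) ^ J := by positivity
    by_cases h : (1 / 2) ^ (J + 1) ≤ x
    · rw [if_pos h, pow_succ]; linarith
    · have h0 : (0 : ℝ) ≤ ∑ j ∈ Finset.range J,
          (0 + (1 / 2) ^ j * if (1 / 2) ^ (j + 1) ≤ x then (1 : ℝ) else 0) :=
        Finset.sum_nonneg fun j _ => by split_ifs <;> positivity
      rw [if_neg h]
      linarith [not_le.1 h]

open Classical in
/-- A variable with values at most one whose expectation is not small is large, at some dyadic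
scale, with a probability which is inversely proportional to that scale. -/
lemma exists_scale (D : PMF α) {X : α → ℝ} (hX : ∀ a, X a ≤ 1) {J : ℕ} (hJ : 0 < J)
    (hE : 2 * (1 / 2) ^ J ≤ expect D X) :
    ∃ j < J, 2 ^ j * (1 / 2) ^ J / J ≤
      expect D fun a => if (1 / 2) ^ (j + 1) ≤ X a then (1 : ℝ) else 0 := by
  -- If every scale fell short, each of the J terms of the dyadic bound would have expectation below
  -- 2^-J / J, and the mean of X would be below 2 · 2^-J.
  by_contra! hcon
  have h1 := expect_mono D fun a => le_dyadic_sum (hX a) J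
  rw [expect_const_add_mul, expect_sum] at h1
  simp only [expect_const_add_mul] at h1
  have hJ' : (0 : ℝ) < J := Nat.cast_pos.2 hJ
  have h2 : ∑ j ∈ Finset.range J, (0 + (1 / 2) ^ j *
      expect D fun a => if (1 / 2) ^ (j + 1) ≤ X a then (1 : ℝ) else 0) <
        ∑ _j ∈ Finset.range J, (1 / 2 : ℝ) ^ J / J := by
    refine Finset.sum_lt_sum_of_nonempty (Finset.nonempty_range_iff.2 hJ.ne') fun j hj => ?_
    have h3 := mul_lt_mul_of_pos_left (hcon j (Finset.mem_range.1 hj))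
      (show (0 : ℝ) < (1 / 2) ^ j by positivity)
    have h4 : (1 / 2 : ℝ) ^ j * (2 ^ j * (1 / 2) ^ J / J) = (1 / 2) ^ J / J := by
      rw [← mul_div_assoc, ← mul_assoc, ← mul_pow]; norm_num
    rw [h4] at h3
    linarith
  rw [Finset.sum_const, Finset.card_range, nsmul_eq_mul, mul_div_cancel₀ _ hJ'.ne'] at h2
  linarith

end Expect

/-! ### Parameters and error analysis of the tester -/

section Scales

/-- The number of query sets which are tested at scale `j`. -/
def numSets (J j : ℕ) : ℕ := 8 * J * 2 ^ (J - 1 - j)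

/-- The number of queries to each query set at scale `j`. -/
def numDraws (J j : ℕ) : ℕ := 96 * J * 4 ^ (j + 1)

/-- Half of the discrepancy that scale `j` is meant to detect. -/
def tolerance (j : ℕ) : ℝ := (1 / 2) ^ (j + 1) / 2

lemma tolerance_nonneg (j : ℕ) : 0 ≤ tolerance j := by unfold tolerance; positivity

lemma tolerance_le_two (j : ℕ) : tolerance j ≤ 2 := by
  have : (1 / 2 : ℝ) ^ (j + 1) ≤ 1 := pow_le_one₀ (by norm_num) (by norm_num)
  unfold tolerance
  linarith

/-- The factor 96 4^(j+1) in `numDraws` makes the Chernoff exponent the same at all scales. -/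
lemma numDraws_mul_tolerance_sq (J j : ℕ) :
    (numDraws J j : ℝ) * tolerance j ^ 2 / 4 = 6 * J := by
  have h : (4 : ℝ) ^ (j + 1) * ((1 / 2) ^ (j + 1)) ^ 2 = 1 := by
    rw [← pow_mul, mul_comm (j + 1) 2, pow_mul, ← mul_pow]; norm_num
  rw [numDraws, tolerance]
  push_cast
  linear_combination (6 * J : ℝ) * h

lemma sum_pow_le (J : ℕ) : ∑ j : Fin J, 2 ^ (j : ℕ) ≤ 2 ^ J := by
  rw [Fin.sum_univ_eq_sum_range fun j => 2 ^ j, Nat.geomSum_eq le_rfl]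
  simp

lemma sum_pow_rev_le (J : ℕ) : ∑ j : Fin J, 2 ^ (J - 1 - (j : ℕ)) ≤ 2 ^ J := by
  rw [Fin.sum_univ_eq_sum_range fun j => 2 ^ (J - 1 - j), Finset.sum_range_reflect (fun j => 2 ^ j),
    ← Fin.sum_univ_eq_sum_range fun j => 2 ^ j]
  exact sum_pow_le J

lemma card_blocks_le (J : ℕ) : Fintype.card (Σ j : Fin J, Fin (numSets J j)) ≤ 8 * J * 2 ^ J := by
  rw [Fintype.card_sigma]
  simp only [Fintype.card_fin]
  unfold numSets
  rw [← Finset.mul_sum]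
  exact Nat.mul_le_mul_left _ (sum_pow_rev_le J)

/-- The tester which looks for discrepancies at the scales `1/2, 1/4, …, 1/2 ^ J` in query sets
drawn from `D`. -/
def scaleTester (D : PMF (QuerySet n)) (q : PMF (Fin n)) (J : ℕ) : NACondAlgorithm n :=
  blockTester (ι := Σ j : Fin J, Fin (numSets J j)) D q (fun i => numDraws J i.1)
    fun i => numDraws J i.1 * tolerance i.1

/-- Scale j costs 1536 J^2 2^J 2^j queries, so the sum is geometric and dominated by the finest
scale. -/
lemma numQueries_scaleTester_le (D : PMF (QuerySet n)) (q : PMF (Fin n)) (J : ℕ) :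
    (scaleTester D q J).numQueries ≤ 1536 * J ^ 2 * 4 ^ J := by
  have h : (scaleTester D q J).numQueries =
      ∑ j : Fin J, numSets J j * numDraws J j := by
    simp [scaleTester, blockTester, Fintype.card_sigma, Fintype.sum_sigma]
  have h1 : ∀ j : Fin J, numSets J j * numDraws J j = 1536 * J ^ 2 * 2 ^ J * 2 ^ (j : ℕ) := by
    intro j
    obtain ⟨m, hm⟩ : ∃ m, J = m + j + 1 := ⟨J - 1 - j, by omega⟩
    have h2 : J - 1 - (j : ℕ) = m := by omega
    have h3 : (2 : ℕ) ^ J = 2 ^ m * 2 ^ (j : ℕ) * 2 := by rw [← pow_add, ← pow_succ, ← hm]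
    have h4 : (4 : ℕ) ^ ((j : ℕ) + 1) = 2 ^ (j : ℕ) * 2 ^ (j : ℕ) * 4 := by
      rw [pow_succ, ← mul_pow]; norm_num
    rw [numSets, numDraws, h2, h3, h4]
    ring
  rw [h, Finset.sum_congr rfl fun j _ => h1 j, ← Finset.mul_sum]
  refine (Nat.mul_le_mul_left _ (sum_pow_le J)).trans_eq ?_
  rw [mul_assoc, ← mul_pow]; norm_num

/-- The union bound: at most 8 J 2^J blocks, each failing with probability at most 2 e^(-6J). Since
J and 2^J are at most e^J, the product is at most 16 e^(-4J) ≤ 16/48. -/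
lemma error_mul_le {J : ℕ} (hJ : 0 < J) :
    8 * J * 2 ^ J * (2 * Real.exp (-(6 * J))) ≤ (1 / 3 : ℝ) := by
  have hJ1 : (1 : ℝ) ≤ J := Nat.one_le_cast.2 hJ
  have h1 : (J : ℝ) ≤ Real.exp J := by linarith [Real.add_one_le_exp (J : ℝ)]
  have h2 : (2 : ℝ) ^ J ≤ Real.exp J := by
    have := pow_le_pow_left₀ (by norm_num) (Real.add_one_le_exp (1 : ℝ)) J
    rw [← Real.exp_nat_mul, mul_one] at this
    norm_num at this
    exact this
  have h3 : Real.exp (-(4 * J)) ≤ 1 / 48 := by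
    have h4 : Real.exp (-(4 * J)) ≤ Real.exp (-4) := Real.exp_le_exp.2 (by linarith)
    have h5 : (2.7 : ℝ) ^ 4 ≤ Real.exp 4 := by
      have := pow_le_pow_left₀ (by norm_num)
        (show (2.7 : ℝ) ≤ Real.exp 1 by linarith [Real.exp_one_gt_d9]) 4
      rw [← Real.exp_nat_mul] at this
      norm_num at this ⊢
      exact this
    have h6 : Real.exp (-4) ≤ 1 / 48 := by
      rw [Real.exp_neg, ← one_div]
      exact one_div_le_one_div_of_le (by norm_num) (le_trans (by norm_num) h5)
    linarith
  have h7 : (J : ℝ) * 2 ^ J ≤ Real.exp J * Real.exp J :=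
    mul_le_mul h1 h2 (by positivity) (Real.exp_pos _).le
  have h8 : Real.exp J * Real.exp J * Real.exp (-(6 * J)) = Real.exp (-(4 * J)) := by
    rw [← Real.exp_add, ← Real.exp_add]; congr 1; ring
  have h9 := mul_le_mul_of_nonneg_right h7 (Real.exp_pos (-(6 * (J : ℝ)))).le
  rw [h8] at h9
  linarith

lemma error_le_half {J : ℕ} (hJ : 0 < J) : 2 * Real.exp (-(6 * J)) ≤ (1 / 2 : ℝ) := by
  have h := error_mul_le hJ
  have hJ1 : (1 : ℝ) ≤ J := Nat.one_le_cast.2 hJ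
  have h2 : (1 : ℝ) ≤ 2 ^ J := one_le_pow₀ (by norm_num)
  have h3 : (1 : ℝ) ≤ 8 * J * 2 ^ J := by nlinarith
  have h4 := le_mul_of_one_le_left (by positivity : 0 ≤ 2 * Real.exp (-(6 * (J : ℝ)))) h3
  linarith

/-- As the acceptance probability is a product over blocks, Bernoulli's inequality plays the role of
the union bound. -/
lemma two_thirds_le_run_scaleTester_self (D : PMF (QuerySet n)) (q : PMF (Fin n)) {J : ℕ}
    (hJ : 0 < J) : 2 / 3 ≤ ((scaleTester D q J).run q true).toReal := by
  have hη := error_le_half hJ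
  have hη' := error_mul_le hJ
  have hpos : (0 : ℝ) ≤ 2 * Real.exp (-(6 * J)) := by positivity
  rw [scaleTester, run_blockTester_true]
  calc (2 / 3 : ℝ) ≤ 1 + Fintype.card (Σ j : Fin J, Fin (numSets J j)) *
        (-(2 * Real.exp (-(6 * J)))) := by
        have h1 : (Fintype.card (Σ j : Fin J, Fin (numSets J j)) : ℝ) ≤ 8 * J * 2 ^ J := by
          exact_mod_cast card_blocks_le J
        have h2 := mul_le_mul_of_nonneg_right h1 hpos
        linarith
    _ ≤ (1 + -(2 * Real.exp (-(6 * J)))) ^ Fintype.card (Σ j : Fin J, Fin (numSets J j)) :=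
        one_add_mul_le_pow (by linarith) _
    _ = ∏ _i : (Σ j : Fin J, Fin (numSets J j)), (1 + -(2 * Real.exp (-(6 * J)))) := by
        rw [Finset.prod_const, Finset.card_univ]
    _ ≤ _ := by
        refine Finset.prod_le_prod (fun i _ => by linarith) fun i _ => ?_
        rw [← expect_const D (1 + _)]
        refine expect_mono D fun S => ?_
        have h := one_sub_le_acceptProb_self q S (tolerance_nonneg i.1) (tolerance_le_two i.1)
          (numDraws J i.1)
        rwa [numDraws_mul_tolerance_sq] at h

/-- Only the scale j provided by `exists_scale` matters; the factors of the other scales are at most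
1. -/
lemma run_scaleTester_le (D : PMF (QuerySet n)) (p q : PMF (Fin n)) {J : ℕ} (hJ : 0 < J)
    (hE : 2 * (1 / 2) ^ J ≤ expect D (discrepancy p q)) :
    ((scaleTester D q J).run p true).toReal ≤ 1 / 3 := by
  classical
  obtain ⟨j, hj, hprob⟩ := exists_scale D (discrepancy_le_one p q) hJ hE
  have hJ0 : (0 : ℝ) < J := Nat.cast_pos.2 hJ
  set r : ℕ → ℝ := fun j =>
    expect D (acceptProb p q (numDraws J j) (numDraws J j * tolerance j)) with hr
  have hr0 : ∀ j, 0 ≤ r j := fun j => by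
    rw [← expect_const D 0]; exact expect_mono D fun S => acceptProb_nonneg _ _ _ _ _
  have hr1 : ∀ j, r j ≤ 1 := fun j =>
    (expect_mono D fun S => acceptProb_le_one _ _ _ _ _).trans_eq (expect_const D 1)
  -- A block accepts with probability at most 1/2 when its discrepancy is large, hence overall at
  -- most 1 - P/2 ≤ e^(-P/2), where P is the probability of a large discrepancy.
  have hrj : r j ≤ Real.exp (-(2 ^ j * (1 / 2) ^ J / J / 2)) := by
    have h1 : r j ≤ expect D fun S =>
        1 + (-1 / 2) * if (1 / 2) ^ (j + 1) ≤ discrepancy p q S then (1 : ℝ) else 0 := by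
      refine expect_mono D fun S => ?_
      split_ifs with h
      · have h2 := acceptProb_le_of_le_discrepancy p q S (tolerance_nonneg j)
          (tolerance_le_two j) (numDraws J j) (by rw [tolerance]; linarith)
        rw [numDraws_mul_tolerance_sq] at h2
        linarith [error_le_half hJ]
      · linarith [acceptProb_le_one p q (numDraws J j) (numDraws J j * tolerance j) S]
    rw [expect_const_add_mul] at h1
    have h2 := Real.add_one_le_exp (-(2 ^ j * (1 / 2 : ℝ) ^ J / J / 2))
    linarith
  rw [scaleTester, run_blockTester_true, Fintype.prod_sigma]
  simp only [Finset.prod_const, Finset.card_univ, Fintype.card_fin]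
  rw [← Finset.mul_prod_erase Finset.univ _ (Finset.mem_univ (⟨j, hj⟩ : Fin J))]
  have hrest : ∏ i ∈ Finset.univ.erase (⟨j, hj⟩ : Fin J), r i ^ numSets J i ≤ 1 :=
    Finset.prod_le_one (fun i _ => pow_nonneg (hr0 _) _) fun i _ => pow_le_one₀ (hr0 _) (hr1 _)
  have hmain : r j ^ numSets J j ≤ 1 / 3 := by
    refine (pow_le_pow_left₀ (hr0 j) hrj _).trans ?_
    rw [← Real.exp_nat_mul]
    have h1 : (2 : ℝ) ^ (J - 1 - j) * 2 ^ j * 2 * (1 / 2) ^ J = 1 := by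
      rw [← pow_add, ← pow_succ, show J - 1 - j + j + 1 = J by omega, ← mul_pow]; norm_num
    -- The factor 8 in `numSets` makes the exponent -2, and e^2 ≥ 3.
    have h2 : (numSets J j : ℝ) * -(2 ^ j * (1 / 2) ^ J / J / 2) = -2 := by
      rw [numSets]
      push_cast
      have h3 : 8 * J * (2 : ℝ) ^ (J - 1 - j) * -(2 ^ j * (1 / 2) ^ J / J / 2) =
          -(4 * ((2 : ℝ) ^ (J - 1 - j) * 2 ^ j * (1 / 2) ^ J)) * (J / J) := by ring
      rw [div_self hJ0.ne'] at h3
      linear_combination h3 - 2 * h1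
    rw [h2, Real.exp_neg, ← one_div]
    refine one_div_le_one_div_of_le (by norm_num) ?_
    linarith [Real.add_one_le_exp (2 : ℝ)]
  exact (mul_le_of_le_one_right (pow_nonneg (hr0 j) _) hrest).trans hmain

lemma two_thirds_le_run_scaleTester_false (D : PMF (QuerySet n)) (p q : PMF (Fin n)) {J : ℕ}
    (hJ : 0 < J) (hE : 2 * (1 / 2) ^ J ≤ expect D (discrepancy p q)) :
    2 / 3 ≤ ((scaleTester D q J).run p false).toReal := by
  have h := sum_toReal_eq_one ((scaleTester D q J).run p)
  rw [Fintype.sum_bool] at h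
  linarith [run_scaleTester_le D p q hJ hE]

end Scales

/-! ### The identity tester and its number of queries -/

/-- The depth of the tree of repeated halvings of `[n]`. -/
def treeDepth (n : ℕ) : ℕ := Nat.clog 2 n

/-- The number of scales at which discrepancies are looked for. -/
def numScales (n : ℕ) (ε : ℝ) : ℕ := Nat.clog 2 ⌈2 * treeDepth n / ε⌉₊

/-- The tester that makes no queries and always answers "equal". -/
def trivialTester (n : ℕ) : NACondAlgorithm n where
  numQueries := 0
  querySets := PMF.pure fun t => t.elim0
  verdict _ _ := PMF.pure true

open Classical in
/-- The identity tester: query random nodes of the tree of repeated halvings of `[n]`, and compare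
how the answers split between the two children with what is expected for `q`. -/
def identityTester (n : ℕ) (q : PMF (Fin n)) (ε : ℝ) : NACondAlgorithm n :=
  if h : treeDepth n ≠ 0 then
    haveI : NeZero (treeDepth n) := ⟨h⟩
    scaleTester (randomNode q (treeDepth n)) q (numScales n ε)
  else trivialTester n

lemma treeDepth_ne_zero (hn : 2 ≤ n) : treeDepth n ≠ 0 := (Nat.clog_pos (by norm_num) hn).ne'

lemma identityTester_of_two_le (hn : 2 ≤ n) (q : PMF (Fin n)) (ε : ℝ) [NeZero (treeDepth n)] :
    identityTester n q ε = scaleTester (randomNode q (treeDepth n)) q (numScales n ε) := by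
  rw [identityTester, dif_pos (treeDepth_ne_zero hn)]

lemma identityTester_of_lt_two (hn : n < 2) (q : PMF (Fin n)) (ε : ℝ) :
    identityTester n q ε = trivialTester n := by
  rw [identityTester, dif_neg]
  exact not_not.2 (Nat.clog_of_right_le_one (by omega) 2)

lemma run_trivialTester (p : PMF (Fin n)) : (trivialTester n).run p = PMF.pure true := by
  simp [NACondAlgorithm.run, trivialTester, PMF.bind_const]

lemma one_le_logb {n : ℕ} (hn : 2 ≤ n) : 1 ≤ Real.logb 2 n := by
  rw [Real.le_logb_iff_rpow_le (by norm_num) (by positivity), Real.rpow_one]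
  exact_mod_cast hn

lemma treeDepth_le {n : ℕ} (hn : 2 ≤ n) : (treeDepth n : ℝ) ≤ 2 * Real.logb 2 n := by
  have h1 := one_le_logb hn
  have h2 := Nat.ceil_lt_add_one (zero_le_one.trans h1)
  have h3 : ⌈Real.logb 2 n⌉₊ = treeDepth n := by
    exact_mod_cast Real.natCeil_logb_natCast 2 n
  rw [h3] at h2
  linarith

lemma two_mul_div_le_two_pow_numScales (n : ℕ) (ε : ℝ) :
    2 * treeDepth n / ε ≤ 2 ^ numScales n ε := by
  have h : ⌈2 * treeDepth n / ε⌉₊ ≤ 2 ^ numScales n ε := Nat.le_pow_clog Nat.one_lt_two _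
  refine (Nat.le_ceil _).trans ?_
  exact_mod_cast Nat.cast_le (α := ℝ).2 h

lemma one_lt_ceil (hn : 2 ≤ n) {ε : ℝ} (h0 : 0 < ε) (h1 : ε ≤ 1) :
    1 < ⌈2 * treeDepth n / ε⌉₊ := by
  have hL : (1 : ℝ) ≤ treeDepth n := Nat.one_le_cast.2 (Nat.pos_of_ne_zero (treeDepth_ne_zero hn))
  rw [Nat.lt_ceil, lt_div_iff₀ h0]
  push_cast
  linarith

lemma numScales_pos (hn : 2 ≤ n) {ε : ℝ} (h0 : 0 < ε) (h1 : ε ≤ 1) : 0 < numScales n ε :=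
  Nat.clog_pos (by norm_num) (one_lt_ceil hn h0 h1)

/-- Rounding up to a power of two at most doubles, and the roundings in `treeDepth` and in the
ceiling are absorbed because log n and log n / ε are at least 1. -/
lemma two_pow_numScales_le (hn : 2 ≤ n) {ε : ℝ} (h0 : 0 < ε) (h1 : ε ≤ 1) :
    (2 : ℝ) ^ numScales n ε ≤ 12 * (Real.logb 2 n / ε) := by
  have hlt := Nat.pow_pred_clog_lt_self (b := 2) (by norm_num) (one_lt_ceil hn h0 h1)
  have hJ := numScales_pos hn h0 h1
  have hle : (2 : ℝ) ^ numScales n ε ≤ 2 * ⌈2 * treeDepth n / ε⌉₊ := by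
    have : 2 ^ numScales n ε = 2 * 2 ^ (numScales n ε).pred := by
      rw [← pow_succ', ← Nat.succ_eq_add_one, Nat.succ_pred_eq_of_pos hJ]
    have h2 : 2 ^ numScales n ε ≤ 2 * ⌈2 * treeDepth n / ε⌉₊ := by
      rw [this]; exact Nat.mul_le_mul_left 2 hlt.le
    exact_mod_cast h2
  have hlog := one_le_logb hn
  have h3 : 1 ≤ Real.logb 2 n / ε := by rw [le_div_iff₀ h0]; linarith
  have h4 : 2 * treeDepth n / ε ≤ 4 * (Real.logb 2 n / ε) := by
    rw [← mul_div_assoc]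
    exact div_le_div_of_nonneg_right (by linarith [treeDepth_le hn]) h0.le
  have h5 := Nat.ceil_lt_add_one (show 0 ≤ 2 * treeDepth n / ε by positivity)
  linarith

lemma numQueries_identityTester_le (hn : 2 ≤ n) (q : PMF (Fin n)) {ε : ℝ} (h0 : 0 < ε)
    (h1 : ε ≤ 1) :
    ((identityTester n q ε).numQueries : ℝ) ≤ 5529600 * (Real.logb 2 n ^ 2 / ε ^ 2) *
      Real.logb 2 (2 + Real.logb 2 n ^ 2 / ε ^ 2) ^ 2 := by
  have : NeZero (treeDepth n) := ⟨treeDepth_ne_zero hn⟩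
  rw [identityTester_of_two_le hn]
  have hq : ((scaleTester (randomNode q (treeDepth n)) q (numScales n ε)).numQueries : ℝ) ≤
      1536 * (numScales n ε : ℝ) ^ 2 * 4 ^ numScales n ε := by
    exact_mod_cast numQueries_scaleTester_le _ q (numScales n ε)
  rw [← div_pow]
  set y := Real.logb 2 n / ε
  set J := numScales n ε
  have hy : 1 ≤ y := by
    rw [le_div_iff₀ h0]; linarith [one_le_logb hn]
  have hpow : (2 : ℝ) ^ J ≤ 12 * y := two_pow_numScales_le hn h0 h1
  have h4 : (4 : ℝ) ^ J ≤ 144 * y ^ 2 := by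
    have := pow_le_pow_left₀ (by positivity) hpow 2
    rw [← pow_mul, mul_comm J 2, pow_mul] at this
    norm_num at this ⊢
    linarith
  have hlog1 : 1 ≤ Real.logb 2 (2 + y ^ 2) := by
    rw [Real.le_logb_iff_rpow_le (by norm_num) (by positivity), Real.rpow_one]
    linarith [sq_nonneg y]
  -- From 2^J ≤ 16 (2 + y^2), J is at most 4 plus the logarithm, and that logarithm is at least 1.
  have hJ : (J : ℝ) ≤ 5 * Real.logb 2 (2 + y ^ 2) := by
    have h2 : (2 : ℝ) ^ J ≤ 2 ^ 4 * (2 + y ^ 2) := hpow.trans (by nlinarith)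
    have h3 := Real.logb_le_logb_of_le (b := 2) (by norm_num) (by positivity) h2
    rw [Real.logb_mul (by positivity) (by positivity), Real.logb_pow, Real.logb_pow,
      Real.logb_self_eq_one (by norm_num)] at h3
    push_cast at h3
    linarith
  have hJ2 := pow_le_pow_left₀ (Nat.cast_nonneg J) hJ 2
  -- The final constant is 5529600 = 1536 · 5^2 · 144.
  have := mul_le_mul hJ2 h4 (by positivity) (by positivity)
  refine hq.trans ?_
  nlinarith

/-- `numScales` is chosen so that 2 · 2^-J ≤ ε/d, the lower bound on the mean discrepancy of a
random node. -/
lemma two_mul_half_pow_le_expect (hn : 2 ≤ n) {p q : PMF (Fin n)} {ε : ℝ} (h0 : 0 < ε)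
    (hfar : ε ≤ tvDist p q) [NeZero (treeDepth n)] :
    2 * (1 / 2) ^ numScales n ε ≤ expect (randomNode q (treeDepth n)) (discrepancy p q) := by
  refine le_trans ?_ (tvDist_div_le_expect_discrepancy p q (treeDepth n)
    (Nat.le_pow_clog (by norm_num) n))
  have hL : (0 : ℝ) < treeDepth n := Nat.cast_pos.2 (Nat.pos_of_ne_zero (treeDepth_ne_zero hn))
  refine le_trans ?_ (div_le_div_of_nonneg_right hfar hL.le)
  have h := two_mul_div_le_two_pow_numScales n ε
  rw [div_le_iff₀ h0] at h
  rw [le_div_iff₀ hL, one_div, inv_pow]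
  have hp : (0 : ℝ) < 2 ^ numScales n ε := by positivity
  field_simp
  linarith

lemma le_apply_of_le_toReal {D : PMF Bool} {b : Bool} (h : 2 / 3 ≤ (D b).toReal) :
    (2 / 3 : ℝ≥0∞) ≤ D b := by
  rw [← ENNReal.ofReal_toReal (D.apply_ne_top b)]
  refine le_trans (le_of_eq ?_) (ENNReal.ofReal_le_ofReal h)
  rw [ENNReal.ofReal_div_of_pos (by norm_num)]
  norm_num

lemma tvDist_self_of_lt_two (hn : n < 2) (p q : PMF (Fin n)) : tvDist p q = 0 := by
  have : Subsingleton (Fin n) := Fin.subsingleton_iff_le_one.2 (by omega)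
  have h : ∀ r : PMF (Fin n), ∀ i, (r i).toReal = 1 := fun r i => by
    rw [← sum_toReal_eq_one r, Fintype.sum_subsingleton _ i]
  simp [tvDist, h]

end CondSampling

end

theorem theorem3 :
    ∃ (A : (n : ℕ) → PMF (Fin n) → ℝ → CondSampling.NACondAlgorithm n) (C : ℝ) (k : ℕ),
      ∀ (n : ℕ) (q : PMF (Fin n)) (ε : ℝ), 0 < ε → ε ≤ 1 →
        ((A n q ε).numQueries : ℝ) ≤
            C * (Real.logb 2 n ^ 2 / ε ^ 2) *
              Real.logb 2 (2 + Real.logb 2 n ^ 2 / ε ^ 2) ^ k ∧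
          ∀ p : PMF (Fin n),
            (p = q → (2 / 3 : ℝ≥0∞) ≤ (A n q ε).run p true) ∧
            (ε ≤ CondSampling.tvDist p q → (2 / 3 : ℝ≥0∞) ≤ (A n q ε).run p false) := by
  refine ⟨CondSampling.identityTester, 5529600, 2, fun n q ε h0 h1 => ?_⟩
  -- For n < 2 the query bound is 0 because log n = 0, so no query may be made; but then no two
  -- distributions are at positive distance.
  rcases lt_or_ge n 2 with hn | hn
  · rw [CondSampling.identityTester_of_lt_two hn]
    refine ⟨?_, fun p => ⟨fun _ => ?_, fun hfar => ?_⟩⟩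
    · simp only [CondSampling.trivialTester, Nat.cast_zero]
      positivity
    · rw [CondSampling.run_trivialTester, PMF.pure_apply, if_pos rfl]
      exact ENNReal.div_le_of_le_mul (by norm_num)
    · rw [CondSampling.tvDist_self_of_lt_two hn] at hfar
      exact absurd hfar (not_le.2 h0)
  · refine ⟨CondSampling.numQueries_identityTester_le hn q h0 h1, fun p => ?_⟩
    have : NeZero (CondSampling.treeDepth n) := ⟨CondSampling.treeDepth_ne_zero hn⟩
    have hJ := CondSampling.numScales_pos hn h0 h1
    rw [CondSampling.identityTester_of_two_le hn]
    refine ⟨?_, fun hfar => ?_⟩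
    · rintro rfl
      exact CondSampling.le_apply_of_le_toReal
        (CondSampling.two_thirds_le_run_scaleTester_self _ _ hJ)
    · exact CondSampling.le_apply_of_le_toReal
        (CondSampling.two_thirds_le_run_scaleTester_false _ _ _ hJ
          (CondSampling.two_mul_half_pow_le_expect hn h0 hfar))
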